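/- Let $E$ be a Polish space, and let $\mathcal M_1$ be the set of all Borel probability measures on $E$, equipped with the weak topology $\mathcal O_{\rm w}$. Let $(\psi_k)_{k\in\mathbb N}$ be any sequence of gauge functions, i.e. of continuous functions $\psi_k:E\to[0,\infty)$. Let $\mathcal M_1^{(\psi_k)}$ be the set of all $\mu\in\mathcal M_1$ with $\int\psi_k\,d\mu<\infty$ for every $k\in\mathbb N$, let $\mathcal C_{\psi_k}$ be the space of all continuous functions $f:E\to\mathbb R$ with $\sup_{x\in E}|f(x)/(1+\psi_k(x))|<\infty$, and let the $(\psi_k)$-weak topology $\mathcal O_{(\psi_k)}$ be the coarsest topology on $\mathcal M_1^{(\psi_k)}$ for which all maps $\mu\mapsto\int f\,d\mu$, $f\in\mathcal C_{\psi_k}$, $k\in\mathbb N$, are continuous. A set $N\subseteq\mathcal M_1$ is called locally uniformly $(\psi_k)$-integrating if for every $\mu\in N$, $\varepsilon>0$ and $k\in\mathbb N$ there exist $a>0$ and a weakly open neighborhood $U$ of $\mu$ such that $\int\psi_k\mathbf 1_{\{\psi_k\ge a\}}\,d\nu\le\varepsilon$ for all $\nu\in N\cap U$. It is called uniformly $(\psi_k)$-integrating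 if for every $\varepsilon>0$ and $k\in\mathbb N$ there exists $a>0$ such that $\sup_{\mu\in N}\int\psi_k\mathbf 1_{\{\psi_k\ge a\}}\,d\mu\le\varepsilon$. A sequence in $\mathcal M_1$ is called uniformly $(\psi_k)$-integrating if the set of its members is. Let $M\subseteq\mathcal M_1^{(\psi_k)}$. Then the following conditions are equivalent: (a) $M$ is a w-set in $\mathcal M_1^{(\psi_k)}$, i.e. $\mathcal O_{(\psi_k)}\cap M=\mathcal O_{\rm w}\cap M$: the relative $(\psi_k)$-weak topology and the relative weak topology on $M$ coincide. (b) $M$ is locally uniformly $(\psi_k)$-integrating. (c) Every weakly compact subset of $M$ is uniformly $(\psi_k)$-integrating. (d) Every sequence in $M$ that converges weakly to an element of $M$ is uniformly $(\psi_k)$-integrating. (e) For every sequence $(\mu_n)_{n\ge1}$ in $M$ and every $\mu_0\in M$ such that $\mu_n\to\mu_0$ weakly, $\int\psi_k\,d\mu_n\to\int\psi_k\,d\mu_0$ for all $k\in\mathbb N$. -/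

import Mathlib

open MeasureTheory Filter Topology
open scoped NNReal ENNReal

noncomputable section

namespace PsiWeak

variable {E : Type*} [TopologicalSpace E] [MeasurableSpace E]

/-- The space `C_φ` of all continuous `f : E → ℝ` with `sup_x |f x / (1 + φ x)| < ∞`,
for a gauge function `φ`, i.e. a continuous function `φ : E → [0, ∞)`. -/
def growthSpace (φ : C(E, ℝ≥0)) : Set (E → ℝ) :=
  {f | Continuous f ∧ BddAbove (Set.range fun x => |f x / (1 + (φ x : ℝ))|)}

/-- The set of all probability measures `μ` on `E` with `∫ ψ_k dμ < ∞` for every `k`. -/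
def gaugeMeasures (ψ : ℕ → C(E, ℝ≥0)) : Set (ProbabilityMeasure E) :=
  {μ | ∀ k, (∫⁻ x, (ψ k x : ℝ≥0∞) ∂(μ : Measure E)) < ∞}

/-- The `(ψ_k)`-weak topology: the coarsest topology on `gaugeMeasures ψ` for which all maps
`μ ↦ ∫ f dμ`, `f ∈ C_{ψ_k}`, `k ∈ ℕ`, are continuous. It is not an instance: the instance on
this subtype is the relative weak topology. -/
@[reducible]
def gaugeWeakTopology (ψ : ℕ → C(E, ℝ≥0)) : TopologicalSpace (gaugeMeasures ψ) :=
  ⨅ (k : ℕ) (f ∈ growthSpace (ψ k)),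
    TopologicalSpace.induced
      (fun μ : gaugeMeasures ψ => ∫ x, f x ∂((μ : ProbabilityMeasure E) : Measure E))
      inferInstance

/-- `M` is a w-set: the relative `(ψ_k)`-weak topology and the relative weak topology on `M`
coincide. -/
def IsWSet [OpensMeasurableSpace E] (ψ : ℕ → C(E, ℝ≥0)) (M : Set (ProbabilityMeasure E))
    (hM : M ⊆ gaugeMeasures ψ) : Prop :=
  TopologicalSpace.induced (Set.inclusion hM) (gaugeWeakTopology ψ) =
    TopologicalSpace.induced (Subtype.val : M → ProbabilityMeasure E) inferInstance

/-- Locally uniformly `(ψ_k)`-integrating sets of probability measures. -/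
def LocallyUniformlyIntegrating [OpensMeasurableSpace E] (ψ : ℕ → C(E, ℝ≥0))
    (M : Set (ProbabilityMeasure E)) : Prop :=
  ∀ μ ∈ M, ∀ ε : ℝ≥0, 0 < ε → ∀ k : ℕ, ∃ a : ℝ≥0, 0 < a ∧
    ∃ U : Set (ProbabilityMeasure E), IsOpen U ∧ μ ∈ U ∧
      ∀ ν ∈ M ∩ U, (∫⁻ x in {x | a ≤ ψ k x}, (ψ k x : ℝ≥0∞) ∂(ν : Measure E)) ≤ (ε : ℝ≥0∞)

/-- Uniformly `(ψ_k)`-integrating sets of probability measures. -/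
def UniformlyIntegrating (ψ : ℕ → C(E, ℝ≥0)) (M : Set (ProbabilityMeasure E)) : Prop :=
  ∀ ε : ℝ≥0, 0 < ε → ∀ k : ℕ, ∃ a : ℝ≥0, 0 < a ∧
    (⨆ μ ∈ M, ∫⁻ x in {x | a ≤ ψ k x}, (ψ k x : ℝ≥0∞) ∂(μ : Measure E)) ≤ (ε : ℝ≥0∞)

end PsiWeak

end

/-!
On `M` the weak topology coincides with the gauge topology iff `μ ↦ ∫ f ∂μ` is weakly continuous on
`M` for all `f` of gauge growth. Truncating such an `f` at a high level gives a weakly continuous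
integral and costs at most a multiple of a tail integral of the gauge. Small tails near each measure
therefore make `μ ↦ ∫ f ∂μ` a locally uniform limit of weakly continuous functions. Conversely, the
tail of a gauge `φ` at level `2 * b` is at most twice the integral lost by truncating `φ` at `b`,
and this loss is weakly continuous when `μ ↦ ∫ φ ∂μ` is; so small tails at one measure persist
nearby.

Since subspaces of a Fréchet–Urysohn space are sequential, continuity of the gauge integrals can be
tested on sequences, and a convergent sequence together with its limit is weakly compact.
-/

namespace PsiWeak

variable {E : Type*} [TopologicalSpace E]

section Truncation

/-- The truncation of a continuous real function to the interval `[-c, c]`, as a bounded continuous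
function, so that its integral depends continuously on the measure in the weak topology. -/
def truncation (f : C(E, ℝ)) (c : ℝ≥0) : BoundedContinuousFunction E ℝ :=
  .ofNormedAddCommGroup (fun x => max (-c) (min (f x) c)) (by fun_prop) c fun x =>
    abs_le.2 ⟨le_max_left _ _, max_le (by linarith [c.coe_nonneg]) (min_le_right _ _)⟩

theorem truncation_apply (f : C(E, ℝ)) (c : ℝ≥0) (x : E) :
    truncation f c x = max (-(c : ℝ)) (min (f x) c) := rfl

theorem truncation_le {f : C(E, ℝ)} {x : E} (hx : 0 ≤ f x) (c : ℝ≥0) :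
    truncation f c x ≤ f x := by
  rw [truncation_apply]
  exact max_le (by linarith [c.coe_nonneg]) (min_le_left _ _)

theorem truncation_le_level (f : C(E, ℝ)) (c : ℝ≥0) (x : E) : truncation f c x ≤ c := by
  rw [truncation_apply]
  exact max_le (by linarith [c.coe_nonneg]) (min_le_right _ _)

theorem abs_sub_truncation (f : C(E, ℝ)) (c : ℝ≥0) (x : E) :
    |f x - truncation f c x| = max 0 (|f x| - c) := by
  have := c.coe_nonneg
  rw [truncation_apply]
  grind

theorem abs_sub_truncation_le_indicator {φ : C(E, ℝ≥0)} {f : C(E, ℝ)} {C : ℝ≥0}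
    (hf : ∀ x, |f x| ≤ C * (1 + φ x)) {a c : ℝ≥0} (hc : C * (1 + a) ≤ c) (x : E) :
    |f x - truncation f c x| ≤ C * {x | a ≤ φ x}.indicator (fun x => (φ x : ℝ)) x := by
  have hc' : (C : ℝ) * (1 + a) ≤ c := mod_cast hc
  rw [abs_sub_truncation, Set.indicator_apply]
  split_ifs with hx
  · have hCa : 0 ≤ (C : ℝ) * a := by positivity
    exact max_le (by positivity) (by linarith [hf x, hc'])
  · rw [mul_zero]
    have hφa : (C : ℝ) * (1 + φ x) ≤ C * (1 + a) := by
      gcongr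
      exact (not_le.1 hx).le
    exact max_le le_rfl (by linarith [hf x, hc'])

end Truncation

section Growth

theorem exists_abs_le_of_mem_growthSpace {φ : C(E, ℝ≥0)} {f : E → ℝ} (hf : f ∈ growthSpace φ) :
    ∃ C : ℝ≥0, 0 < C ∧ ∀ x, |f x| ≤ C * (1 + φ x) := by
  obtain ⟨B, hB⟩ := hf.2
  refine ⟨max 1 B.toNNReal, by positivity, fun x => ?_⟩
  have hx : (0 : ℝ) < 1 + φ x := by positivity
  have hfB : |f x / (1 + φ x)| ≤ B := hB ⟨x, rfl⟩
  rw [abs_div, abs_of_pos hx, div_le_iff₀ hx] at hfB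
  refine hfB.trans (mul_le_mul_of_nonneg_right ?_ hx.le)
  exact (Real.le_coe_toNNReal B).trans (NNReal.coe_le_coe.2 (le_max_right _ _))

theorem mem_growthSpace_of_abs_le {φ : C(E, ℝ≥0)} {f : E → ℝ} (hf : Continuous f) {C : ℝ}
    (hC : ∀ x, |f x| ≤ C * (1 + φ x)) : f ∈ growthSpace φ := by
  refine ⟨hf, C, Set.forall_mem_range.2 fun x => ?_⟩
  have hx : (0 : ℝ) < 1 + φ x := by positivity
  rw [abs_div, abs_of_pos hx, div_le_iff₀ hx]
  exact hC x

theorem abs_coe_gauge_le_one_mul (φ : C(E, ℝ≥0)) (x : E) : |(φ x : ℝ)| ≤ 1 * (1 + φ x) := by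
  rw [abs_of_nonneg (φ x).coe_nonneg]
  linarith

theorem coe_gauge_mem_growthSpace (φ : C(E, ℝ≥0)) : (fun x => (φ x : ℝ)) ∈ growthSpace φ :=
  mem_growthSpace_of_abs_le (by fun_prop) (abs_coe_gauge_le_one_mul φ)

theorem boundedContinuous_mem_growthSpace (φ : C(E, ℝ≥0)) (f : BoundedContinuousFunction E ℝ) :
    (f : E → ℝ) ∈ growthSpace φ :=
  mem_growthSpace_of_abs_le f.continuous fun x => (f.norm_coe_le_norm x).trans <|
    le_mul_of_one_le_right (norm_nonneg f) (by linarith [(φ x).coe_nonneg])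

end Growth

variable [MeasurableSpace E]

section Tail

/-- The tail integral `∫ φ 1_{φ ≥ a} dμ` of a gauge function `φ` at the level `a`, in terms of which
the uniform integrability notions are phrased. -/
noncomputable def tailIntegral (φ : C(E, ℝ≥0)) (μ : Measure E) (a : ℝ≥0) : ℝ≥0∞ :=
  ∫⁻ x in {x | a ≤ φ x}, (φ x : ℝ≥0∞) ∂μ

theorem tailIntegral_antitone (φ : C(E, ℝ≥0)) (μ : Measure E) : Antitone (tailIntegral φ μ) :=
  fun _ _ hab => lintegral_mono_set fun _ hx => hab.trans hx

theorem tailIntegral_le_coe_iff {φ : C(E, ℝ≥0)} {μ : Measure E}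
    (hφ : Integrable (fun x => (φ x : ℝ)) μ) {a ε : ℝ≥0} :
    tailIntegral φ μ a ≤ ε ↔ ∫ x in {x | a ≤ φ x}, (φ x : ℝ) ∂μ ≤ ε := by
  rw [tailIntegral, lintegral_coe_eq_integral _ hφ.integrableOn, ENNReal.ofReal_le_coe]

variable [OpensMeasurableSpace E]

theorem measurableSet_le_gauge (φ : C(E, ℝ≥0)) (a : ℝ≥0) : MeasurableSet {x | a ≤ φ x} :=
  (isClosed_le continuous_const φ.continuous).measurableSet

theorem integrable_coe_gauge {φ : C(E, ℝ≥0)} {μ : Measure E} (hφ : ∫⁻ x, φ x ∂μ < ∞) :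
    Integrable (fun x => (φ x : ℝ)) μ :=
  ⟨(NNReal.continuous_coe.comp φ.continuous).measurable.aestronglyMeasurable,
    hasFiniteIntegral_iff_ofNNReal.2 hφ⟩

theorem integrable_of_mem_growthSpace {φ : C(E, ℝ≥0)} {μ : Measure E} [IsFiniteMeasure μ]
    (hφ : Integrable (fun x => (φ x : ℝ)) μ) {f : E → ℝ} (hf : f ∈ growthSpace φ) :
    Integrable f μ := by
  obtain ⟨C, -, hC⟩ := exists_abs_le_of_mem_growthSpace hf
  exact (((integrable_const 1).add hφ).const_mul (C : ℝ)).mono'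
    hf.1.measurable.aestronglyMeasurable (ae_of_all _ hC)

theorem tendsto_setIntegral_gauge_atTop {φ : C(E, ℝ≥0)} {μ : Measure E}
    (hφ : Integrable (fun x => (φ x : ℝ)) μ) :
    Tendsto (fun a : ℝ≥0 => ∫ x in {x | a ≤ φ x}, (φ x : ℝ) ∂μ) atTop (𝓝 0) := by
  have hempty : ⋂ a : ℝ≥0, {x | a ≤ φ x} = ∅ :=
    Set.iInter_eq_empty_iff.2 fun x => ⟨φ x + 1, not_le.2 (lt_add_one (φ x))⟩
  have htendsto := tendsto_setIntegral_of_antitone (measurableSet_le_gauge φ)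
    (fun _ _ hab _ hx => hab.trans hx) ⟨0, hφ.integrableOn⟩
  rwa [hempty, setIntegral_empty] at htendsto

theorem exists_tailIntegral_le {φ : C(E, ℝ≥0)} {μ : Measure E}
    (hφ : Integrable (fun x => (φ x : ℝ)) μ) {ε : ℝ≥0} (hε : 0 < ε) :
    ∃ a : ℝ≥0, 0 < a ∧ tailIntegral φ μ a ≤ ε := by
  obtain ⟨a, htail, ha⟩ := (((tendsto_setIntegral_gauge_atTop hφ).eventually_le_const
    (NNReal.coe_pos.2 hε)).and (eventually_gt_atTop 0)).exists
  exact ⟨a, ha, (tailIntegral_le_coe_iff hφ).2 htail⟩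

theorem abs_integral_sub_integral_truncation_le {φ : C(E, ℝ≥0)} {μ : Measure E}
    [IsFiniteMeasure μ] (hφ : Integrable (fun x => (φ x : ℝ)) μ) {f : C(E, ℝ)} {C : ℝ≥0}
    (hf : ∀ x, |f x| ≤ C * (1 + φ x)) {a c : ℝ≥0} (hc : C * (1 + a) ≤ c) :
    |∫ x, f x ∂μ - ∫ x, truncation f c x ∂μ| ≤ C * ∫ x in {x | a ≤ φ x}, (φ x : ℝ) ∂μ := by
  have hset := measurableSet_le_gauge φ a
  rw [← integral_sub (integrable_of_mem_growthSpace hφ (mem_growthSpace_of_abs_le f.continuous hf))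
    ((truncation f c).integrable μ), ← integral_indicator hset, ← integral_const_mul]
  exact norm_integral_le_of_norm_le ((hφ.indicator hset).const_mul (C : ℝ))
    (ae_of_all μ fun x => (Real.norm_eq_abs _).trans_le (abs_sub_truncation_le_indicator hf hc x))

theorem setIntegral_le_two_mul_integral_sub_truncation {φ : C(E, ℝ≥0)} {μ : Measure E}
    [IsFiniteMeasure μ] (hφ : Integrable (fun x => (φ x : ℝ)) μ) (b : ℝ≥0) :
    ∫ x in {x | 2 * b ≤ φ x}, (φ x : ℝ) ∂μ ≤
      2 * (∫ x, (φ x : ℝ) ∂μ - ∫ x, truncation (.comp .coeNNRealReal φ) b x ∂μ) := by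
  have hset := measurableSet_le_gauge φ (2 * b)
  have htrunc := (truncation (.comp .coeNNRealReal φ) b).integrable μ
  rw [← integral_sub hφ htrunc, ← integral_indicator hset, ← integral_const_mul]
  refine integral_mono (hφ.indicator hset) ((hφ.sub htrunc).const_mul 2) fun x => ?_
  refine Set.indicator_apply_le' (fun hx => ?_) fun _ => ?_
  · have hx' : 2 * (b : ℝ) ≤ φ x := mod_cast hx
    linarith [truncation_le_level (.comp .coeNNRealReal φ) b x]
  · have hle : truncation (.comp .coeNNRealReal φ) b x ≤ φ x := truncation_le (φ x).coe_nonneg b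
    exact mul_nonneg zero_le_two (sub_nonneg.2 hle)

end Tail

section UniformIntegrability

variable {ψ : ℕ → C(E, ℝ≥0)} {M N : Set (ProbabilityMeasure E)}

theorem uniformlyIntegrating_iff_forall_tailIntegral_le :
    UniformlyIntegrating ψ M ↔ ∀ ε : ℝ≥0, 0 < ε → ∀ k, ∃ a : ℝ≥0, 0 < a ∧
      ∀ μ ∈ M, tailIntegral (ψ k) μ a ≤ ε := by
  simp only [UniformlyIntegrating, tailIntegral, iSup₂_le_iff]

theorem UniformlyIntegrating.mono (hN : UniformlyIntegrating ψ N) (hMN : M ⊆ N) :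
    UniformlyIntegrating ψ M := fun ε hε k =>
  let ⟨a, ha, hle⟩ := hN ε hε k
  ⟨a, ha, (biSup_mono fun _ hμ => hMN hμ).trans hle⟩

variable [OpensMeasurableSpace E]

theorem UniformlyIntegrating.insert (hM : UniformlyIntegrating ψ M) {μ₀ : ProbabilityMeasure E}
    (hμ₀ : μ₀ ∈ gaugeMeasures ψ) : UniformlyIntegrating ψ (insert μ₀ M) := by
  rw [uniformlyIntegrating_iff_forall_tailIntegral_le] at hM ⊢
  intro ε hε k
  obtain ⟨a, ha, haM⟩ := hM ε hε k
  obtain ⟨b, -, hb⟩ := exists_tailIntegral_le (integrable_coe_gauge (hμ₀ k)) hε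
  exact ⟨max a b, lt_max_of_lt_left ha, Set.forall_mem_insert.2
    ⟨(tailIntegral_antitone _ _ (le_max_right a b)).trans hb,
      fun μ hμ => (tailIntegral_antitone _ _ (le_max_left a b)).trans (haM μ hμ)⟩⟩

theorem locallyUniformlyIntegrating_iff_eventually_tailIntegral_le :
    LocallyUniformlyIntegrating ψ M ↔ ∀ μ ∈ M, ∀ ε : ℝ≥0, 0 < ε → ∀ k, ∃ a : ℝ≥0, 0 < a ∧
      ∀ᶠ ν : ProbabilityMeasure E in 𝓝[M] μ, tailIntegral (ψ k) ν a ≤ ε := by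
  simp only [LocallyUniformlyIntegrating, Filter.Eventually, mem_nhdsWithin, Set.inter_comm M]
  rfl

theorem UniformlyIntegrating.locallyUniformlyIntegrating (hM : UniformlyIntegrating ψ M) :
    LocallyUniformlyIntegrating ψ M := by
  rw [uniformlyIntegrating_iff_forall_tailIntegral_le] at hM
  refine locallyUniformlyIntegrating_iff_eventually_tailIntegral_le.2 fun _ _ ε hε k => ?_
  obtain ⟨a, ha, hle⟩ := hM ε hε k
  exact ⟨a, ha, eventually_mem_nhdsWithin.mono hle⟩

theorem LocallyUniformlyIntegrating.mono (hN : LocallyUniformlyIntegrating ψ N) (hMN : M ⊆ N) :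
    LocallyUniformlyIntegrating ψ M := fun μ hμ ε hε k =>
  let ⟨a, ha, U, hU, hμU, hle⟩ := hN μ (hMN hμ) ε hε k
  ⟨a, ha, U, hU, hμU, fun ν hν => hle ν ⟨hMN hν.1, hν.2⟩⟩

theorem LocallyUniformlyIntegrating.uniformlyIntegrating_of_isCompact
    (hM : LocallyUniformlyIntegrating ψ M) (hcompact : IsCompact M) :
    UniformlyIntegrating ψ M := by
  rw [locallyUniformlyIntegrating_iff_eventually_tailIntegral_le] at hM
  refine uniformlyIntegrating_iff_forall_tailIntegral_le.2 fun ε hε k => ?_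
  refine hcompact.induction_on
    (p := fun S => ∃ a : ℝ≥0, 0 < a ∧ ∀ μ ∈ S, tailIntegral (ψ k) μ a ≤ ε)
    ⟨1, one_pos, by simp⟩ ?_ ?_ ?_
  · rintro S T hST ⟨a, ha, hT⟩
    exact ⟨a, ha, fun μ hμ => hT μ (hST hμ)⟩
  · rintro S T ⟨a, ha, hS⟩ ⟨b, -, hT⟩
    refine ⟨max a b, lt_max_of_lt_left ha, fun μ hμ => ?_⟩
    rcases hμ with hμ | hμ
    · exact (tailIntegral_antitone _ _ (le_max_left a b)).trans (hS μ hμ)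
    · exact (tailIntegral_antitone _ _ (le_max_right a b)).trans (hT μ hμ)
  · intro μ hμ
    obtain ⟨a, ha, hle⟩ := hM μ hμ ε hε k
    exact ⟨_, hle, a, ha, fun _ hν => hν⟩

end UniformIntegrability

section Continuity

variable [OpensMeasurableSpace E] {ψ : ℕ → C(E, ℝ≥0)} {M : Set (ProbabilityMeasure E)}

theorem LocallyUniformlyIntegrating.continuousOn_integral (hloc : LocallyUniformlyIntegrating ψ M)
    (hM : M ⊆ gaugeMeasures ψ) {k : ℕ} {f : E → ℝ} (hf : f ∈ growthSpace (ψ k)) :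
    ContinuousOn (fun μ : ProbabilityMeasure E => ∫ x, f x ∂(μ : Measure E)) M := by
  rw [locallyUniformlyIntegrating_iff_eventually_tailIntegral_le] at hloc
  obtain ⟨C, hC, hfC⟩ := exists_abs_le_of_mem_growthSpace hf
  lift f to C(E, ℝ) using hf.1
  refine continuousOn_of_locally_uniform_approx_of_continuousWithinAt fun μ hμ u hu => ?_
  obtain ⟨δ, hδ, hδu⟩ := Metric.mem_uniformity_dist.1 hu
  lift δ to ℝ≥0 using hδ.le
  have hδ : 0 < δ := mod_cast hδ
  obtain ⟨a, -, htail⟩ := hloc μ hμ (δ / 2 / C) (by positivity) k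
  refine ⟨_, htail.and self_mem_nhdsWithin,
    fun ν => ∫ x, truncation f (C * (1 + a)) x ∂(ν : Measure E),
    (ProbabilityMeasure.continuous_integral_boundedContinuousFunction _).continuousWithinAt, ?_⟩
  rintro ν ⟨hν, hνM⟩
  have hψ := integrable_coe_gauge (hM hνM k)
  refine hδu ?_
  calc |∫ x, f x ∂(ν : Measure E) - ∫ x, truncation f (C * (1 + a)) x ∂(ν : Measure E)|
      ≤ C * ∫ x in {x | a ≤ ψ k x}, (ψ k x : ℝ) ∂(ν : Measure E) :=
        abs_integral_sub_integral_truncation_le hψ hfC le_rfl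
    _ ≤ C * (δ / 2 / C) := by
        gcongr
        exact_mod_cast (tailIntegral_le_coe_iff hψ).1 hν
    _ = δ / 2 := mul_div_cancel₀ _ (by positivity)
    _ < δ := half_lt_self (by positivity)

theorem locallyUniformlyIntegrating_of_continuousOn_integral (hM : M ⊆ gaugeMeasures ψ)
    (hcont : ∀ k, ContinuousOn
      (fun μ : ProbabilityMeasure E => ∫ x, (ψ k x : ℝ) ∂(μ : Measure E)) M) :
    LocallyUniformlyIntegrating ψ M := by
  refine locallyUniformlyIntegrating_iff_eventually_tailIntegral_le.2 fun μ hμ ε hε k => ?_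
  let g : C(E, ℝ) := .comp .coeNNRealReal (ψ k)
  obtain ⟨a, -, htail⟩ := exists_tailIntegral_le (integrable_coe_gauge (hM hμ k))
    (show 0 < ε / 4 by positivity)
  let loss : ProbabilityMeasure E → ℝ := fun ν =>
    ∫ x, g x ∂(ν : Measure E) - ∫ x, truncation g (1 + a) x ∂(ν : Measure E)
  have hloss_cont : ContinuousOn loss M := (hcont k).sub
    (ProbabilityMeasure.continuous_integral_boundedContinuousFunction _).continuousOn
  have hloss_lt : loss μ < ε / 2 := by
    have hψ := integrable_coe_gauge (hM hμ k)
    calc loss μ ≤ 1 * ∫ x in {x | a ≤ ψ k x}, (ψ k x : ℝ) ∂(μ : Measure E) :=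
          (le_abs_self _).trans (abs_integral_sub_integral_truncation_le hψ (f := g) (C := 1)
            (abs_coe_gauge_le_one_mul (ψ k)) (one_mul _).le)
      _ ≤ ε / 4 := by
          rw [one_mul]
          exact_mod_cast (tailIntegral_le_coe_iff hψ).1 htail
      _ < ε / 2 := by linarith [NNReal.coe_pos.2 hε]
  refine ⟨2 * (1 + a), by positivity, ?_⟩
  filter_upwards [(hloss_cont μ hμ).eventually_lt_const hloss_lt, self_mem_nhdsWithin]
    with ν hν hνM
  have hψ := integrable_coe_gauge (hM hνM k)
  refine (tailIntegral_le_coe_iff hψ).2 ?_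
  calc ∫ x in {x | 2 * (1 + a) ≤ ψ k x}, (ψ k x : ℝ) ∂(ν : Measure E)
      ≤ 2 * loss ν := setIntegral_le_two_mul_integral_sub_truncation hψ (1 + a)
    _ ≤ ε := by linarith

theorem gaugeWeakTopology_le_induced (ψ : ℕ → C(E, ℝ≥0)) :
    gaugeWeakTopology ψ ≤ TopologicalSpace.induced Subtype.val inferInstance := by
  rw [← continuous_iff_le_induced]
  let := gaugeWeakTopology ψ
  exact ProbabilityMeasure.continuous_iff_forall_continuous_integral.2 fun f =>
    continuous_iff_le_induced.2
      (iInf_le_of_le 0 (iInf₂_le _ (boundedContinuous_mem_growthSpace _ f)))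

theorem isWSet_iff_forall_continuousOn_integral (hM : M ⊆ gaugeMeasures ψ) :
    IsWSet ψ M hM ↔ ∀ k, ∀ f ∈ growthSpace (ψ k),
      ContinuousOn (fun μ : ProbabilityMeasure E => ∫ x, f x ∂(μ : Measure E)) M := by
  have hle : TopologicalSpace.induced (Set.inclusion hM) (gaugeWeakTopology ψ) ≤
      TopologicalSpace.induced (Subtype.val : M → ProbabilityMeasure E) inferInstance :=
    (induced_mono (gaugeWeakTopology_le_induced ψ)).trans induced_compose.le
  rw [IsWSet, le_antisymm_iff, and_iff_right hle]
  simp only [gaugeWeakTopology, induced_iInf, induced_compose, le_iInf_iff,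
    continuousOn_iff_continuous_domRestrict, continuous_iff_le_induced]
  rfl

theorem tendsto_integral_of_uniformlyIntegrating_range {ι : Type*} {l : Filter ι}
    {μ : ι → ProbabilityMeasure E} {μ₀ : ProbabilityMeasure E} (hμ : ∀ n, μ n ∈ gaugeMeasures ψ)
    (hμ₀ : μ₀ ∈ gaugeMeasures ψ) (hlim : Tendsto μ l (𝓝 μ₀))
    (hunif : UniformlyIntegrating ψ (Set.range μ)) {k : ℕ} {f : E → ℝ}
    (hf : f ∈ growthSpace (ψ k)) :
    Tendsto (fun n => ∫ x, f x ∂(μ n : Measure E)) l (𝓝 (∫ x, f x ∂(μ₀ : Measure E))) := by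
  have hcont := (hunif.insert hμ₀).locallyUniformlyIntegrating.continuousOn_integral
    (Set.insert_subset hμ₀ (Set.range_subset_iff.2 hμ)) hf
  exact (hcont μ₀ (Set.mem_insert _ _)).tendsto.comp (tendsto_nhdsWithin_iff.2
    ⟨hlim, .of_forall fun n => Set.mem_insert_of_mem _ (Set.mem_range_self n)⟩)

end Continuity

end PsiWeak

/-- The Fréchet–Urysohn hypothesis holds whenever `E` is a separable pseudometrizable space with its
Borel `σ`-algebra, the weak topology being then induced by the Lévy–Prokhorov distance. -/
theorem mainTheorem1_general {E : Type*} [TopologicalSpace E] [MeasurableSpace E]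
    [OpensMeasurableSpace E] [FrechetUrysohnSpace (ProbabilityMeasure E)] (ψ : ℕ → C(E, ℝ≥0))
    (M : Set (ProbabilityMeasure E)) (hM : M ⊆ PsiWeak.gaugeMeasures ψ) :
    List.TFAE [
      PsiWeak.IsWSet ψ M hM,
      PsiWeak.LocallyUniformlyIntegrating ψ M,
      ∀ K : Set (ProbabilityMeasure E), K ⊆ M → IsCompact K → PsiWeak.UniformlyIntegrating ψ K,
      ∀ μ : ℕ → ProbabilityMeasure E, (∀ n, μ n ∈ M) →
        (∃ μ₀ ∈ M, Tendsto μ atTop (𝓝 μ₀)) → PsiWeak.UniformlyIntegrating ψ (Set.range μ),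
      ∀ μ : ℕ → ProbabilityMeasure E, (∀ n, μ n ∈ M) → ∀ μ₀ ∈ M,
        Tendsto μ atTop (𝓝 μ₀) →
          ∀ k : ℕ, Tendsto (fun n => ∫ x, (ψ k x : ℝ) ∂(μ n : Measure E)) atTop
            (𝓝 (∫ x, (ψ k x : ℝ) ∂(μ₀ : Measure E)))] := by
  tfae_have 1 → 5 := fun h μ hμ μ₀ hμ₀ hlim k =>
    ((PsiWeak.isWSet_iff_forall_continuousOn_integral hM).1 h k _
      (PsiWeak.coe_gauge_mem_growthSpace (ψ k)) μ₀ hμ₀).tendsto.comp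
        (tendsto_nhdsWithin_iff.2 ⟨hlim, .of_forall hμ⟩)
  tfae_have 5 → 2 := fun h =>
    PsiWeak.locallyUniformlyIntegrating_of_continuousOn_integral hM fun k =>
      continuousOn_iff_continuous_domRestrict.2 <| continuous_iff_seqContinuous.2
        fun μ μ₀ hlim => h (fun n => μ n) (fun n => (μ n).2) μ₀ μ₀.2 (tendsto_subtype_rng.1 hlim) k
  tfae_have 2 → 1 := fun h =>
    (PsiWeak.isWSet_iff_forall_continuousOn_integral hM).2 fun _ _ => h.continuousOn_integral hM
  tfae_have 2 → 3 := fun h K hKM => (h.mono hKM).uniformlyIntegrating_of_isCompact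
  tfae_have 3 → 4 := fun h μ hμ ⟨μ₀, hμ₀, hlim⟩ =>
    (h _ (Set.insert_subset hμ₀ (Set.range_subset_iff.2 hμ)) hlim.isCompact_insert_range).mono
      (Set.subset_insert _ _)
  tfae_have 4 → 5 := fun h μ hμ μ₀ hμ₀ hlim k =>
    PsiWeak.tendsto_integral_of_uniformlyIntegrating_range (fun n => hM (hμ n)) (hM hμ₀) hlim
      (h μ hμ ⟨μ₀, hμ₀, hlim⟩) (PsiWeak.coe_gauge_mem_growthSpace (ψ k))
  tfae_finish

theorem mainTheorem1 {E : Type*} [TopologicalSpace E] [PolishSpace E] [MeasurableSpace E]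
    [BorelSpace E] (ψ : ℕ → C(E, ℝ≥0)) (M : Set (ProbabilityMeasure E))
    (hM : M ⊆ PsiWeak.gaugeMeasures ψ) :
    List.TFAE [
      PsiWeak.IsWSet ψ M hM,
      PsiWeak.LocallyUniformlyIntegrating ψ M,
      ∀ K : Set (ProbabilityMeasure E), K ⊆ M → IsCompact K → PsiWeak.UniformlyIntegrating ψ K,
      ∀ μ : ℕ → ProbabilityMeasure E, (∀ n, μ n ∈ M) →
        (∃ μ₀ ∈ M, Tendsto μ atTop (𝓝 μ₀)) → PsiWeak.UniformlyIntegrating ψ (Set.range μ),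
      ∀ μ : ℕ → ProbabilityMeasure E, (∀ n, μ n ∈ M) → ∀ μ₀ ∈ M,
        Tendsto μ atTop (𝓝 μ₀) →
          ∀ k : ℕ, Tendsto (fun n => ∫ x, (ψ k x : ℝ) ∂(μ n : Measure E)) atTop
            (𝓝 (∫ x, (ψ k x : ℝ) ∂(μ₀ : Measure E)))] :=
  mainTheorem1_general ψ M hM
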